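/- Let $\Omega=(\Omega,\le,\mathsf k,\otimes)$ be a Lawverean quantale: a complete lattice with a commutative monoid structure whose tensor distributes over arbitrary joins, which is integral ($\mathsf k=\top$), cointegral ($\varepsilon\otimes\delta=\bot$ implies $\varepsilon=\bot$ or $\delta=\bot$) and non-trivial ($\mathsf k\ne\bot$). For $\Omega$-relations $R:A\times B\to\Omega$ and $S:B\times C\to\Omega$ (ordered pointwise) put $(R;S)(a,c)=\bigvee_b R(a,b)\otimes S(b,c)$ and $R^{-}(b,a)=R(a,b)$; let $\Delta$ be the diagonal ($\mathsf k$ on equal elements, $\bot$ elsewhere). For $R:A\times A\to\Omega$ let $R^0=\Delta$, $R^{n+1}=R;R^n$, $R^{=}=R\vee\Delta$, $R^*=\bigvee_n R^n$. $R$ is *confluent* if $(R^*)^-;R^*\le R^*;(R^*)^-$. It is *strongly confluent* if (s1) $R^-;R\le R^{=};(R^*)^-$, and *strongly closed* if moreover (s2) $R^-;R\le R^*;(R^{=})^-$. (1) Every strongly confluent $\Omega$-relation on a set is confluent. Assume now that $\Omega$ is also continuous: $\varepsilon=\bigvee\{\delta\mid\delta\ll\varepsilon\}$ for all $\varepsilon$,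 where $\ll$ is the way-below relation. Let $X$ be a countably infinite set of variables. An $\Omega$-TRS $\mathcal R=(\Sigma,\mapsto)$ consists of a signature $\Sigma$ and a ternary relation $a\mapsto^{\varepsilon}b$ (the rules) between $\Sigma$-terms over $X$, with degree $\varepsilon\in\Omega$, that is antitone in $\varepsilon$. (The redex $a$ may be a variable, and the contractum $b$ may contain variables that do not occur in $a$.) It generates the least ternary relation $\to$ such that: $a\mapsto^\varepsilon b$ implies $C[a^\sigma]\to^\varepsilon C[b^\sigma]$ for all one-hole contexts $C$ and substitutions $\sigma$; $t\to^\varepsilon s$ and $\delta\le\varepsilon$ imply $t\to^\delta s$; $t\to^{\varepsilon_i}s$ for $i=1,\dots,n$ implies $t\to^{\bigvee_i\varepsilon_i}s$; and $t\to^\delta s$ for all $\delta\ll\varepsilon$ implies $t\to^\varepsilon s$. Put $R(t,s)=\bigvee\{\varepsilon\mid t\to^\varepsilon s\}$; properties of $R$ are attributed to $\mathcal R$. $\mathcal R$ is *linear* if no variable occurs twice in the left-hand side of a rule, nor twice in the right-hand side. A *critical pair* of $\mathcal R$ is a pair $(c_2^\sigma[d_1^\sigma]_p,\ d_2^\sigma)$,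 where $c_1\mapsto^\varepsilon d_1$ and $c_2\mapsto^\delta d_2$ are variable renamings of rules of $\mathcal R$ without common variables, $p$ is a position of $c_2$ at which there is a function symbol, and $\sigma$ is a most general unifier of $c_1$ and $c_2|_p$; the case where $p$ is the root, $(c_1,d_1)$ and $(c_2,d_2)$ are variable renamings of each other, and every variable of $d_1$ occurs in $c_1$ is excluded. $\mathcal R$ is *strongly closed on its critical pairs* if (s1) and (s2), evaluated at $(t,s)$, hold for every critical pair $(t,s)$ of $\mathcal R$. (2) A linear $\Omega$-TRS is strongly closed if and only if it is strongly closed on all its critical pairs. (3) If a linear $\Omega$-TRS is strongly closed on all its critical pairs, then it is confluent (no termination assumption is made). -/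

import Mathlib

universe u v w x y

namespace QRewriting

/-! ### Quantales -/

/-- A Lawverean quantale: a commutative unital quantale that is integral, cointegral and
non-trivial. The order and joins are those of the complete lattice, the tensor is `*`, the unit
is `1`. -/
class LawvereanQuantale (Ω : Type u) [CommMonoid Ω] [CompleteLattice Ω] : Prop
    extends IsQuantale Ω where
  integral : (1 : Ω) = ⊤
  cointegral : ∀ ε δ : Ω, ε * δ = ⊥ → ε = ⊥ ∨ δ = ⊥
  nontrivial : (1 : Ω) ≠ ⊥

/-- The way-below relation `δ ≪ ε`. -/
def WayBelow {Ω : Type u} [CompleteLattice Ω] (δ ε : Ω) : Prop :=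
  ∀ A : Set Ω, ε ≤ sSup A → ∃ A₀ : Set Ω, A₀ ⊆ A ∧ A₀.Finite ∧ δ ≤ sSup A₀

/-- Every element is the join of the elements way below it. -/
def IsContinuous (Ω : Type u) [CompleteLattice Ω] : Prop :=
  ∀ ε : Ω, ε = sSup {δ : Ω | WayBelow δ ε}

/-! ### Quantale-valued relations, ordered pointwise -/

/-- An `Ω`-valued relation from `A` to `B`. -/
abbrev QRel (Ω : Type u) (A : Type v) (B : Type w) : Type (max u v w) := A → B → Ω

namespace QRel

variable {Ω : Type u} [CommMonoid Ω] [CompleteLattice Ω] {A : Type v} {B : Type w} {C : Type x}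

/-- Composition `R ; S`. -/
def comp (R : QRel Ω A B) (S : QRel Ω B C) : QRel Ω A C := fun a c => ⨆ b, R a b * S b c

/-- The transpose of `R`. -/
def conv (R : QRel Ω A B) : QRel Ω B A := fun b a => R a b

open Classical in
/-- The diagonal relation. -/
noncomputable def diag (Ω : Type u) [CommMonoid Ω] [CompleteLattice Ω] (A : Type v) :
    QRel Ω A A := fun a b => if a = b then 1 else ⊥

/-- The iterates: `R ^ 0` is the diagonal and `R ^ (n + 1) = R ; R ^ n`. -/
noncomputable def iter (R : QRel Ω A A) : ℕ → QRel Ω A A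
  | 0 => diag Ω A
  | n + 1 => comp R (iter R n)

/-- The reflexive closure. -/
noncomputable def reflClosure (R : QRel Ω A A) : QRel Ω A A := R ⊔ diag Ω A

/-- The reflexive and transitive closure. -/
noncomputable def star (R : QRel Ω A A) : QRel Ω A A := ⨆ n : ℕ, iter R n

/-- `R` commutes with `S`. -/
def Commutes (R S : QRel Ω A A) : Prop := comp (conv R) S ≤ comp S (conv R)

/-- The diamond property. -/
def Diamond (R : QRel Ω A A) : Prop := Commutes R R

/-- Confluence: the reflexive and transitive closure has the diamond property. -/
def Confluent (R : QRel Ω A A) : Prop := Diamond (star R)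

/-- Strong confluence. -/
def StronglyConfluent (R : QRel Ω A A) : Prop :=
  comp (conv R) R ≤ comp (reflClosure R) (conv (star R))

/-- Strong closure. -/
def StronglyClosed (R : QRel Ω A A) : Prop :=
  StronglyConfluent R ∧ comp (conv R) R ≤ comp (star R) (conv (reflClosure R))

/-- The two inequalities of strong closure, at a single pair. -/
def StronglyClosedAt (R : QRel Ω A A) (a b : A) : Prop :=
  comp (conv R) R a b ≤ comp (reflClosure R) (conv (star R)) a b ∧
    comp (conv R) R a b ≤ comp (star R) (conv (reflClosure R)) a b

end QRel

/-! ### Terms: positions, contexts, linearity, most general unifiers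

The signature consists of the function symbols of `L`; relation symbols play no role. -/

section Terms

variable {L : FirstOrder.Language.{u, v}} {X : Type w}

/-- The subterm at a position, if the position exists. Positions are strings of argument indices,
counted from `0`. -/
def subtermAt : L.Term X → List ℕ → Option (L.Term X)
  | t, [] => some t
  | .var _, _ :: _ => none
  | .func (l := n) _ ts, i :: p => if h : i < n then subtermAt (ts ⟨i, h⟩) p else none

/-- `replaceAt t p s` is `t[s]_p`, the result of replacing the subterm of `t` at `p` by `s`. It is
`t` if `p` is not a position of `t`. -/
def replaceAt : L.Term X → List ℕ → L.Term X → L.Term X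
  | _, [], s => s
  | .var z, _ :: _, _ => .var z
  | .func f ts, i :: p, s =>
      .func f (fun j => if (j : ℕ) = i then replaceAt (ts j) p s else ts j)

/-- The variable `z` occurs in `t`. -/
def OccursIn (z : X) (t : L.Term X) : Prop := ∃ p, subtermAt t p = some (.var z)

/-- A term is linear if no variable has two occurrences in it. -/
def IsLinear (t : L.Term X) : Prop :=
  ∀ (z : X) (p q : List ℕ), subtermAt t p = some (.var z) → subtermAt t q = some (.var z) → p = q

/-- `p` is a function symbol position of `t` with subterm `s`. -/
def IsFunctionPosition (t : L.Term X) (p : List ℕ) (s : L.Term X) : Prop :=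
  subtermAt t p = some s ∧ ∀ z : X, s ≠ .var z

/-- Contexts with exactly one hole. In `node f i ts C` the hole is in the `i`-th argument `C`, and
the other arguments of `f` are those of `ts`; the entry `ts i` is ignored. -/
inductive Ctx (L : FirstOrder.Language.{u, v}) (X : Type w) : Type (max u w)
  | hole : Ctx L X
  | node {n : ℕ} (f : L.Functions n) (i : Fin n) (ts : Fin n → L.Term X) (C : Ctx L X) : Ctx L X

/-- `C.fill t` is `C[t]`. -/
def Ctx.fill : Ctx L X → L.Term X → L.Term X
  | .hole, t => t
  | .node f i ts C, t => .func f (Function.update ts i (C.fill t))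

/-- `σ` is a most general unifier of `s` and `t`. -/
def IsMGU (σ : X → L.Term X) (s t : L.Term X) : Prop :=
  s.subst σ = t.subst σ ∧
    ∀ τ : X → L.Term X, s.subst τ = t.subst τ → ∃ ρ : X → L.Term X, ∀ z, τ z = (σ z).subst ρ

end Terms

/-! ### Quantale-valued term rewriting systems -/

section Systems

/-- An `Ω`-valued term rewriting system: a ternary relation `rule a ε b` on terms that is antitone
in the degree `ε`. -/
structure QTRS (Ω : Type u) [CompleteLattice Ω] (L : FirstOrder.Language.{v, w}) (X : Type x) where
  rule : L.Term X → Ω → L.Term X → Prop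
  antitone : ∀ {a b : L.Term X} {ε δ : Ω}, δ ≤ ε → rule a ε b → rule a δ b

namespace QTRS

variable {Ω : Type u} [CompleteLattice Ω] {L : FirstOrder.Language.{v, w}} {X : Type x}

/-- The ternary rewriting relation generated by the rules. -/
inductive Step (T : QTRS Ω L X) : Ω → L.Term X → L.Term X → Prop
  | ofRule {a b : L.Term X} {ε : Ω} (C : Ctx L X) (σ : X → L.Term X) (h : T.rule a ε b) :
      Step T ε (C.fill (a.subst σ)) (C.fill (b.subst σ))
  | weaken {t s : L.Term X} {ε δ : Ω} (h : Step T ε t s) (hle : δ ≤ ε) : Step T δ t s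
  | join {t s : L.Term X} {n : ℕ} (ε : Fin n → Ω) (h : ∀ i, Step T (ε i) t s) :
      Step T (⨆ i, ε i) t s
  | archimedean {t s : L.Term X} {ε : Ω} (h : ∀ δ, WayBelow δ ε → Step T δ t s) : Step T ε t s

/-- The rewriting `Ω`-relation of the system. -/
def rel (T : QTRS Ω L X) : QRel Ω (L.Term X) (L.Term X) := fun t s => sSup {ε | T.Step ε t s}

/-- Both sides of every rule are linear terms. -/
def Linear (T : QTRS Ω L X) : Prop :=
  ∀ (a : L.Term X) (ε : Ω) (b : L.Term X), T.rule a ε b → IsLinear a ∧ IsLinear b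

/-- The rule `c ↦ d` with degree `ε` is a renaming of a rule of the system. -/
def IsRenamedRule (T : QTRS Ω L X) (c : L.Term X) (ε : Ω) (d : L.Term X) : Prop :=
  ∃ (a b : L.Term X) (π : Equiv.Perm X), T.rule a ε b ∧ c = a.relabel π ∧ d = b.relabel π

/-- The rules `c₁ ↦ d₁` and `c₂ ↦ d₂` are variants: one is a variable renaming of the other. -/
def Variants (c₁ d₁ c₂ d₂ : L.Term X) : Prop :=
  ∃ π : Equiv.Perm X, c₂ = c₁.relabel π ∧ d₂ = d₁.relabel π

/-- The rules `c₁ ↦ d₁` and `c₂ ↦ d₂` have no common variable. -/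
def NoCommonVariable (c₁ d₁ c₂ d₂ : L.Term X) : Prop :=
  ∀ z : X, ¬ ((OccursIn z c₁ ∨ OccursIn z d₁) ∧ (OccursIn z c₂ ∨ OccursIn z d₂))

/-- `(t, s)` is a critical pair: `c₁ ↦ d₁` and `c₂ ↦ d₂` are renamed rules without common variables,
`σ` is a most general unifier of `c₁` and the subterm `r` of `c₂` at the function symbol position
`p`, and `t = (c₂ σ)[d₁ σ]_p`, `s = d₂ σ`. Overlaps of two variants at the root are
discarded if all variables of the contractum occur in the redex. (If some do not, such an overlap
is a genuine one: the two contracta can differ.) -/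
def IsCriticalPair (T : QTRS Ω L X) (t s : L.Term X) : Prop :=
  ∃ (c₁ d₁ c₂ d₂ r : L.Term X) (ε δ : Ω) (p : List ℕ) (σ : X → L.Term X),
    T.IsRenamedRule c₁ ε d₁ ∧ T.IsRenamedRule c₂ δ d₂ ∧
    NoCommonVariable c₁ d₁ c₂ d₂ ∧
    IsFunctionPosition c₂ p r ∧
    IsMGU σ c₁ r ∧
    ¬ (p = [] ∧ Variants c₁ d₁ c₂ d₂ ∧ ∀ z, OccursIn z d₁ → OccursIn z c₁) ∧
    t = replaceAt (c₂.subst σ) p (d₁.subst σ) ∧ s = d₂.subst σ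

/-- The system is strongly closed on all its critical pairs. -/
def StronglyClosedOnCriticalPairs [CommMonoid Ω] (T : QTRS Ω L X) : Prop :=
  ∀ t s : L.Term X, T.IsCriticalPair t s → QRel.StronglyClosedAt T.rel t s

end QTRS

end Systems

end QRewriting

/-!
The first claim is relation algebra. With `E = R^=` and `K = (R^*)⁻`, strong confluence says that
`E ; K` absorbs `R⁻` on the left, so `K ; R ≤ E ; K` by star induction; this makes `R^* ; K` absorb
`R` on the right, and a second star induction gives `K ; R^* ≤ R^* ; K`. See
`QRewriting.QRel.StronglyConfluent.confluent`.

For a linear system over a continuous quantale, the degree `R(t, s)` is just the join of the degrees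
of the single rule applications leading from `t` to `s` (`QRewriting.QTRS.rel_le`): the closure
conditions in the definition of the ternary relation add nothing to it. Since the tensor distributes
over joins, strong closure therefore has to be checked only on peaks of two rule applications
`C₁[a₁ σ₁] = C₂[a₂ σ₂]`, of degrees `ε` and `δ`, where it says that the contracta are joinable to
the degree `ε ⊗ δ`. This notion, `QRewriting.QRel.Joins`, is symmetric in the two contracta and
stable under contexts and substitutions. Walking down the two contexts leaves three kinds of peaks:

* The redexes are disjoint. Then the two steps commute.
* One redex lies below a variable of the other rule. By linearity it has a single copy in the other
  redex and at most one residual, so each contractum needs at most one further step; where no step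
  is needed, integrality bounds the degree that is lost (`QRewriting.QTRS.joins_of_variable`).
* One redex overlaps a function symbol position of the other rule. After renaming the rules apart,
  the peak is an instance of a critical pair, or the overlap is an excluded one, in which the two
  contracta are equal (`QRewriting.QTRS.joins_of_overlap`).

The last case needs the existence of most general unifiers, `QRewriting.exists_isMGU`. As a unifier
`τ` is at hand, the usual termination order of the unification algorithm is not needed: the size of
the equations instantiated by `τ` decreases in each step.
-/

/-! ### Quantale-valued relation algebra -/

namespace QRewriting.QRel

theorem conv_mono {Ω : Type u} [CompleteLattice Ω] {A : Type v} {B : Type w} {R S : QRel Ω A B}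
    (h : R ≤ S) : conv R ≤ conv S := fun b a => h a b

variable {Ω : Type u} [CommMonoid Ω] [CompleteLattice Ω]
  {A : Type v} {B : Type w} {C : Type x} {D : Type y}

theorem diag_self (a : A) : diag Ω A a a = 1 := if_pos rfl

theorem diag_of_ne {a b : A} (h : a ≠ b) : diag Ω A a b = ⊥ := if_neg h

theorem mul_le_comp (R : QRel Ω A B) (S : QRel Ω B C) (a : A) (b : B) (c : C) :
    R a b * S b c ≤ comp R S a c := le_iSup (fun b => R a b * S b c) b

theorem conv_comp (R : QRel Ω A B) (S : QRel Ω B C) :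
    conv (comp R S) = comp (conv S) (conv R) := by
  funext c a
  simp only [conv, comp, mul_comm]

theorem conv_diag : conv (diag Ω A) = diag Ω A := by
  funext a b
  by_cases h : a = b
  · rw [h]
    rfl
  · rw [conv, diag_of_ne h, diag_of_ne (Ne.symm h)]

theorem diag_le_reflClosure (R : QRel Ω A A) : diag Ω A ≤ reflClosure R := le_sup_right

theorem le_reflClosure (R : QRel Ω A A) : R ≤ reflClosure R := le_sup_left

theorem iter_le_star (R : QRel Ω A A) (n : ℕ) : iter R n ≤ star R := le_iSup (iter R) n

theorem diag_le_star (R : QRel Ω A A) : diag Ω A ≤ star R := iter_le_star R 0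

section IsQuantale

variable [IsQuantale Ω]

theorem comp_mono {R R' : QRel Ω A B} {S S' : QRel Ω B C} (hR : R ≤ R') (hS : S ≤ S') :
    comp R S ≤ comp R' S' :=
  fun a c => iSup_mono fun b => mul_le_mul' (hR a b) (hS b c)

theorem comp_assoc (R : QRel Ω A B) (S : QRel Ω B C) (T : QRel Ω C D) :
    comp (comp R S) T = comp R (comp S T) := by
  funext a d
  simp only [comp, Quantale.mul_iSup_distrib, Quantale.iSup_mul_distrib, mul_assoc]
  exact iSup_comm

theorem comp_iSup {ι : Type*} (R : QRel Ω A B) (S : ι → QRel Ω B C) :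
    comp R (⨆ i, S i) = ⨆ i, comp R (S i) := by
  funext a c
  simp only [comp, iSup_apply, Quantale.mul_iSup_distrib]
  exact iSup_comm

theorem iSup_comp {ι : Type*} (R : ι → QRel Ω A B) (S : QRel Ω B C) :
    comp (⨆ i, R i) S = ⨆ i, comp (R i) S := by
  funext a c
  simp only [comp, iSup_apply, Quantale.iSup_mul_distrib]
  exact iSup_comm

theorem sup_comp (R R' : QRel Ω A B) (S : QRel Ω B C) :
    comp (R ⊔ R') S = comp R S ⊔ comp R' S := by
  funext a c
  simp only [comp, Pi.sup_apply, Quantale.sup_mul_distrib, iSup_sup_eq]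

theorem comp_sup (R : QRel Ω A B) (S S' : QRel Ω B C) :
    comp R (S ⊔ S') = comp R S ⊔ comp R S' := by
  funext a c
  simp only [comp, Pi.sup_apply, Quantale.mul_sup_distrib, iSup_sup_eq]

theorem diag_comp (R : QRel Ω A B) : comp (diag Ω A) R = R := by
  funext a b
  refine le_antisymm (iSup_le fun c => ?_) ?_
  · by_cases h : a = c
    · subst h
      rw [diag_self, one_mul]
    · rw [diag_of_ne h, Quantale.bot_mul]
      exact bot_le
  · simpa [diag_self] using mul_le_comp (diag Ω A) R a a b

theorem comp_diag (R : QRel Ω A B) : comp R (diag Ω B) = R :=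
  congrArg conv (show conv (comp R (diag Ω B)) = conv R by rw [conv_comp, conv_diag, diag_comp])

theorem le_star (R : QRel Ω A A) : R ≤ star R := by
  have h := iter_le_star R 1
  rwa [iter, iter, comp_diag] at h

theorem reflClosure_le_star (R : QRel Ω A A) : reflClosure R ≤ star R :=
  sup_le (le_star R) (diag_le_star R)

/-- Right star induction. -/
theorem comp_star_le {R : QRel Ω B B} {S : QRel Ω A B} (h : comp S R ≤ S) :
    comp S (star R) ≤ S := by
  rw [star, comp_iSup]
  refine iSup_le fun n => ?_
  induction n with
  | zero => exact (comp_diag S).le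
  | succ n ih =>
    rw [iter, ← comp_assoc]
    exact (comp_mono h le_rfl).trans ih

/-- Left star induction for the transpose. -/
theorem conv_star_comp_le {R : QRel Ω A A} {S : QRel Ω A B} (h : comp (conv R) S ≤ S) :
    comp (conv (star R)) S ≤ S := by
  have h' : comp (conv S) R ≤ conv S := by
    have h'' := conv_mono h
    rwa [conv_comp] at h''
  have hs := conv_mono (comp_star_le h')
  rwa [conv_comp] at hs

theorem star_comp_self_le (R : QRel Ω A A) : comp (star R) R ≤ star R := by
  have h : ∀ n, comp (iter R n) R ≤ iter R (n + 1) := by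
    intro n
    induction n with
    | zero =>
      simp only [iter, diag_comp, comp_diag, le_refl]
    | succ n ih =>
      rw [iter, comp_assoc]
      exact comp_mono le_rfl ih
  rw [star, iSup_comp]
  exact iSup_le fun n => (h n).trans (iter_le_star R (n + 1))

theorem star_comp_star_le (R : QRel Ω A A) : comp (star R) (star R) ≤ star R :=
  comp_star_le (star_comp_self_le R)

theorem conv_star_comp_conv_star_le (R : QRel Ω A A) :
    comp (conv (star R)) (conv (star R)) ≤ conv (star R) := by
  simpa only [conv_comp] using conv_mono (star_comp_star_le R)

/-- Both halves are star inductions: first `(R^*)⁻ ; R ≤ R^= ; (R^*)⁻`, then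
`(R^*)⁻ ; R^* ≤ R^* ; (R^*)⁻`. -/
theorem StronglyConfluent.confluent {R : QRel Ω A A} (h : StronglyConfluent R) :
    Confluent R := by
  set E := reflClosure R with hE
  set K := conv (star R) with hK
  have hKK : comp K K ≤ K := conv_star_comp_conv_star_le R
  have hcK : conv R ≤ K := conv_mono (le_star R)
  have hdK : diag Ω A ≤ K := by
    simpa only [conv_diag] using conv_mono (diag_le_star R)
  have hKE : K ≤ comp E K := by
    simpa only [diag_comp] using comp_mono (diag_le_reflClosure R) (le_refl K)
  have hstrip : comp K R ≤ comp E K := by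
    have hind : comp (conv R) (comp E K) ≤ comp E K := by
      rw [← comp_assoc, hE, reflClosure, comp_sup, sup_comp, comp_diag, ← reflClosure, ← hE]
      refine sup_le ?_ (((comp_mono hcK le_rfl).trans hKK).trans hKE)
      refine (comp_mono h le_rfl).trans ?_
      rw [comp_assoc]
      exact comp_mono le_rfl hKK
    have hR : R ≤ comp E K := by
      simpa only [comp_diag] using comp_mono (le_reflClosure R) hdK
    exact (comp_mono le_rfl hR).trans (conv_star_comp_le hind)
  have hind : comp (comp (star R) K) R ≤ comp (star R) K := by
    rw [comp_assoc]
    refine (comp_mono le_rfl hstrip).trans ?_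
    rw [← comp_assoc]
    exact comp_mono ((comp_mono le_rfl (reflClosure_le_star R)).trans (star_comp_star_le R)) le_rfl
  have hKs : K ≤ comp (star R) K := by
    simpa only [diag_comp] using comp_mono (diag_le_star R) (le_refl K)
  exact (comp_mono hKs le_rfl).trans (comp_star_le hind)

end IsQuantale

/-! ### Joinability to a degree -/

theorem diag_map_le (φ : A → A) (a b : A) : diag Ω A a b ≤ diag Ω A (φ a) (φ b) := by
  by_cases h : a = b
  · rw [h, diag_self, diag_self]
  · rw [diag_of_ne h]
    exact bot_le

theorem reflClosure_map_le {R : QRel Ω A A} {φ : A → A}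
    (h : ∀ a b, R a b ≤ R (φ a) (φ b)) (a b : A) :
    reflClosure R a b ≤ reflClosure R (φ a) (φ b) :=
  sup_le_sup (h a b) (diag_map_le φ a b)

/-- The pair `(a, b)` is joinable to the degree `ε`, in both of the ways that strong closure
demands. -/
def Joins (R : QRel Ω A A) (ε : Ω) (a b : A) : Prop :=
  ε ≤ comp (reflClosure R) (conv (star R)) a b ∧ ε ≤ comp (star R) (conv (reflClosure R)) a b

theorem Joins.symm {R : QRel Ω A A} {ε : Ω} {a b : A} (h : Joins R ε a b) : Joins R ε b a := by
  refine ⟨h.2.trans_eq ?_, h.1.trans_eq ?_⟩ <;> simp only [comp, conv, mul_comm]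

theorem Joins.mono {R : QRel Ω A A} {ε δ : Ω} {a b : A} (h : Joins R ε a b) (hle : δ ≤ ε) :
    Joins R δ a b := ⟨hle.trans h.1, hle.trans h.2⟩

section IsQuantale

variable [IsQuantale Ω]

theorem Joins.of_le {R : QRel Ω A A} {ε δ : Ω} {a b c : A} (ha : ε ≤ reflClosure R a c)
    (hb : δ ≤ reflClosure R b c) : Joins R (ε * δ) a b :=
  ⟨(mul_le_mul' ha (hb.trans (reflClosure_le_star R b c))).trans
      (mul_le_comp (reflClosure R) (conv (star R)) a c b),
    (mul_le_mul' (ha.trans (reflClosure_le_star R a c)) hb).trans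
      (mul_le_comp (star R) (conv (reflClosure R)) a c b)⟩

variable {R : QRel Ω A A} {φ : A → A}

theorem comp_map_le {S T : QRel Ω A A} (hS : ∀ a b, S a b ≤ S (φ a) (φ b))
    (hT : ∀ a b, T a b ≤ T (φ a) (φ b)) (a b : A) : comp S T a b ≤ comp S T (φ a) (φ b) :=
  iSup_le fun c => (mul_le_mul' (hS a c) (hT c b)).trans (mul_le_comp S T (φ a) (φ c) (φ b))

theorem star_map_le (h : ∀ a b, R a b ≤ R (φ a) (φ b)) (a b : A) :
    star R a b ≤ star R (φ a) (φ b) := by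
  have hn : ∀ n a b, iter R n a b ≤ iter R n (φ a) (φ b) := by
    intro n
    induction n with
    | zero => exact diag_map_le φ
    | succ n ih => exact comp_map_le h ih
  simp only [star, iSup_apply]
  exact iSup_mono fun n => hn n a b

theorem Joins.map {ε : Ω} {a b : A} (h : ∀ a b, R a b ≤ R (φ a) (φ b)) (hab : Joins R ε a b) :
    Joins R ε (φ a) (φ b) :=
  ⟨hab.1.trans (comp_map_le (reflClosure_map_le h)
      (fun a b => star_map_le h b a) a b),
    hab.2.trans (comp_map_le (star_map_le h) (fun a b => reflClosure_map_le h b a) a b)⟩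

end IsQuantale

/-- By integrality any degree is at most `1`, the degree of a trivial join. -/
theorem Joins.refl [LawvereanQuantale Ω] (R : QRel Ω A A) (ε : Ω) (a : A) : Joins R ε a a := by
  have h : (1 : Ω) ≤ reflClosure R a a := (diag_self a).ge.trans (diag_le_reflClosure R a a)
  refine (Joins.of_le h h).mono ?_
  rw [mul_one, LawvereanQuantale.integral]
  exact le_top

end QRewriting.QRel

/-! ### Substitution and occurrences of variables -/

namespace QRewriting

open FirstOrder.Language (Term)

variable {L : FirstOrder.Language.{u, v}} {X : Type w}

theorem subst_subst (t : L.Term X) (σ τ : X → L.Term X) :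
    (t.subst σ).subst τ = t.subst fun z => (σ z).subst τ := by
  induction t with
  | var z => rfl
  | func f ts ih => simp only [Term.subst, ih]

theorem relabel_eq_subst (t : L.Term X) (g : X → X) :
    t.relabel g = t.subst fun z => .var (g z) := by
  induction t with
  | var z => rfl
  | func f ts ih => simp only [Term.subst, Term.relabel, ih]

theorem relabel_subst (t : L.Term X) (g : X → X) (σ : X → L.Term X) :
    (t.relabel g).subst σ = t.subst (σ ∘ g) := by
  rw [relabel_eq_subst, subst_subst]
  rfl

theorem subtermAt_nil (t : L.Term X) : subtermAt t [] = some t := by rw [subtermAt]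

theorem replaceAt_nil (t v : L.Term X) : replaceAt t [] v = v := by rw [replaceAt]

theorem subtermAt_func_cons {n : ℕ} (f : L.Functions n) (ts : Fin n → L.Term X) (i : Fin n)
    (p : List ℕ) : subtermAt (.func f ts) (i :: p) = subtermAt (ts i) p := by
  simp only [subtermAt, i.isLt, dif_pos]

theorem exists_of_subtermAt_cons {t r : L.Term X} {k : ℕ} {p : List ℕ}
    (h : subtermAt t (k :: p) = some r) :
    ∃ (n : ℕ) (f : L.Functions n) (ts : Fin n → L.Term X) (i : Fin n),
      t = .func f ts ∧ k = i ∧ subtermAt (ts i) p = some r := by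
  cases t with
  | var z => simp [subtermAt] at h
  | @func n f ts =>
    rw [subtermAt] at h
    split at h
    · exact ⟨n, f, ts, _, rfl, rfl, h⟩
    · simp at h

theorem replaceAt_func_cons {n : ℕ} (f : L.Functions n) (ts : Fin n → L.Term X) (i : Fin n)
    (p : List ℕ) (v : L.Term X) :
    replaceAt (.func f ts) (i :: p) v = .func f (Function.update ts i (replaceAt (ts i) p v)) := by
  rw [replaceAt]
  congr 1
  funext j
  by_cases h : j = i
  · subst h
    simp
  · simp [h, Fin.val_inj]

theorem subst_func_update {n : ℕ} (f : L.Functions n) (ts : Fin n → L.Term X) (i : Fin n)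
    (v : L.Term X) (σ : X → L.Term X) :
    Term.subst (.func f (Function.update ts i v)) σ =
      .func f (Function.update (fun j => (ts j).subst σ) i (v.subst σ)) := by
  rw [Term.subst]
  congr 1
  funext j
  exact Function.apply_update (fun _ t => Term.subst t σ) ts i v j

theorem subtermAt_subst {t r : L.Term X} {p : List ℕ} (h : subtermAt t p = some r)
    (σ : X → L.Term X) : subtermAt (t.subst σ) p = some (r.subst σ) := by
  induction p generalizing t with
  | nil =>
    simp only [subtermAt, Option.some.injEq] at h ⊢
    rw [h]
  | cons k p ih =>
    obtain ⟨n, f, ts, i, rfl, rfl, h'⟩ := exists_of_subtermAt_cons h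
    rw [Term.subst, subtermAt_func_cons]
    exact ih h'

theorem replaceAt_subst {t r : L.Term X} {p : List ℕ} (h : subtermAt t p = some r)
    (v : L.Term X) (σ : X → L.Term X) :
    (replaceAt t p v).subst σ = replaceAt (t.subst σ) p (v.subst σ) := by
  induction p generalizing t with
  | nil => simp only [replaceAt_nil]
  | cons k p ih =>
    obtain ⟨n, f, ts, i, rfl, rfl, h'⟩ := exists_of_subtermAt_cons h
    rw [replaceAt_func_cons, subst_func_update, ih h', Term.subst, replaceAt_func_cons]

theorem replaceAt_self {t r : L.Term X} {p : List ℕ} (h : subtermAt t p = some r) :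
    replaceAt t p r = t := by
  induction p generalizing t with
  | nil =>
    rw [subtermAt_nil, Option.some.injEq] at h
    rw [replaceAt_nil, h]
  | cons k p ih =>
    obtain ⟨n, f, ts, i, rfl, rfl, h'⟩ := exists_of_subtermAt_cons h
    rw [replaceAt_func_cons, ih h', Function.update_eq_self]

theorem exists_ctx_fill_eq_replaceAt {t r : L.Term X} {p : List ℕ} (h : subtermAt t p = some r) :
    ∃ C : Ctx L X, ∀ v, C.fill v = replaceAt t p v := by
  induction p generalizing t with
  | nil => exact ⟨.hole, fun v => (replaceAt_nil t v).symm⟩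
  | cons k p ih =>
    obtain ⟨n, f, ts, i, rfl, rfl, h'⟩ := exists_of_subtermAt_cons h
    obtain ⟨C, hC⟩ := ih h'
    exact ⟨.node f i ts C, fun v => by rw [Ctx.fill, hC, replaceAt_func_cons]⟩

theorem exists_ctx_fill_fill (C D : Ctx L X) : ∃ E : Ctx L X, ∀ t, E.fill t = C.fill (D.fill t) := by
  induction C with
  | hole => exact ⟨D, fun t => rfl⟩
  | node f i ts C ih =>
    obtain ⟨E, hE⟩ := ih
    exact ⟨.node f i ts E, fun t => by rw [Ctx.fill, Ctx.fill, hE]⟩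

theorem exists_ctx_fill_subst (C : Ctx L X) (σ : X → L.Term X) :
    ∃ E : Ctx L X, ∀ t, E.fill (t.subst σ) = (C.fill t).subst σ := by
  induction C with
  | hole => exact ⟨.hole, fun t => rfl⟩
  | node f i ts C ih =>
    obtain ⟨E, hE⟩ := ih
    exact ⟨.node f i (fun j => (ts j).subst σ) E, fun t => by
      rw [Ctx.fill, Ctx.fill, hE, subst_func_update]⟩

theorem occursIn_var {x z : X} : OccursIn z (.var x : L.Term X) ↔ z = x := by
  constructor
  · rintro ⟨_ | ⟨k, p⟩, h⟩
    · simpa [subtermAt, eq_comm] using h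
    · simp [subtermAt] at h
  · rintro rfl
    exact ⟨[], rfl⟩

theorem occursIn_func {n : ℕ} {f : L.Functions n} {ts : Fin n → L.Term X} {z : X} :
    OccursIn z (.func f ts) ↔ ∃ i, OccursIn z (ts i) := by
  constructor
  · rintro ⟨_ | ⟨k, p⟩, h⟩
    · simp [subtermAt] at h
    · rw [subtermAt] at h
      split at h
      · exact ⟨_, p, h⟩
      · simp at h
  · rintro ⟨i, p, h⟩
    exact ⟨i :: p, by rwa [subtermAt_func_cons]⟩

theorem finite_setOf_occursIn (t : L.Term X) : {z | OccursIn z t}.Finite := by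
  induction t with
  | var x => simp only [occursIn_var, Set.ofPred_eq_eq_singleton, Set.finite_singleton]
  | func f ts ih =>
    simp only [occursIn_func, Set.ofPred_exists]
    exact Set.finite_iUnion ih

theorem subst_eq_subst_iff {t : L.Term X} {σ τ : X → L.Term X} :
    t.subst σ = t.subst τ ↔ ∀ z, OccursIn z t → σ z = τ z := by
  induction t with
  | var x => simp [Term.subst, occursIn_var]
  | func f ts ih =>
    simp only [Term.subst, Term.func.injEq, heq_eq_eq, true_and, occursIn_func, funext_iff, ih]
    exact ⟨fun h z ⟨i, hi⟩ => h i z hi, fun h i z hi => h z ⟨i, hi⟩⟩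

/-! ### Linear terms -/

theorem IsLinear.arg {n : ℕ} {f : L.Functions n} {ts : Fin n → L.Term X}
    (h : IsLinear (.func f ts)) (i : Fin n) : IsLinear (ts i) := fun z p q hp hq =>
  (List.cons.inj (h z (i :: p) (i :: q) (by rwa [subtermAt_func_cons])
    (by rwa [subtermAt_func_cons]))).2

/-- In an instance of a linear term, replacing the copy of `σ x` under a variable `x` amounts to
changing `σ` at `x`. -/
theorem IsLinear.replaceAt_subst [DecidableEq X] {t : L.Term X} (ht : IsLinear t) {p : List ℕ}
    {x : X} (h : subtermAt t p = some (.var x)) (σ : X → L.Term X) (v : L.Term X) :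
    replaceAt (t.subst σ) p v = t.subst (Function.update σ x v) := by
  induction p generalizing t with
  | nil =>
    rw [subtermAt_nil, Option.some.injEq] at h
    subst h
    simp [replaceAt, Term.subst]
  | cons k p ih =>
    obtain ⟨n, f, ts, i, rfl, rfl, h'⟩ := exists_of_subtermAt_cons h
    rw [Term.subst, replaceAt_func_cons, ih (ht.arg i) h', Term.subst]
    congr 1
    funext j
    by_cases hj : j = i
    · subst hj
      simp
    · rw [Function.update_of_ne hj, subst_eq_subst_iff]
      rintro z ⟨q, hq⟩
      refine (Function.update_of_ne ?_ _ _).symm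
      rintro rfl
      have := ht z (j :: q) (i :: p) (by rwa [subtermAt_func_cons]) h
      exact hj (Fin.ext (List.cons.inj this).1)

/-! ### Most general unifiers -/

/-- The number of symbols of a term. -/
def termSize : L.Term X → ℕ
  | .var _ => 1
  | .func _ ts => 1 + ∑ i, termSize (ts i)

theorem termSize_pos (t : L.Term X) : 0 < termSize t := by
  cases t <;> simp [termSize]

theorem termSize_arg_lt {n : ℕ} (f : L.Functions n) (ts : Fin n → L.Term X) (i : Fin n) :
    termSize (ts i) < termSize (.func f ts) := by
  have := Finset.single_le_sum (f := fun i => termSize (ts i)) (fun _ _ => Nat.zero_le _)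
    (Finset.mem_univ i)
  simp only [termSize] at this ⊢
  omega

theorem termSize_le_of_occursIn {z : X} {t : L.Term X} (h : OccursIn z t) (σ : X → L.Term X) :
    termSize (σ z) ≤ termSize (t.subst σ) := by
  induction t with
  | var x => rw [occursIn_var.1 h, Term.subst]
  | func f ts ih =>
    obtain ⟨i, hi⟩ := occursIn_func.1 h
    exact (ih i hi).trans (termSize_arg_lt f (fun i => (ts i).subst σ) i).le

/-- The occurs check: a variable can be unified only with itself and with the terms in which it
does not occur. -/
theorem not_occursIn_of_unifies {z : X} {t : L.Term X} {σ : X → L.Term X} (h : σ z = t.subst σ)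
    (ht : t ≠ .var z) : ¬ OccursIn z t := by
  intro ho
  cases t with
  | var x => exact ht (by rw [occursIn_var.1 ho])
  | func f ts =>
    obtain ⟨i, hi⟩ := occursIn_func.1 ho
    have h1 := termSize_le_of_occursIn hi σ
    have h2 := termSize_arg_lt f (fun i => (ts i).subst σ) i
    rw [h, Term.subst] at h1
    omega

/-- `σ` solves every equation of the list `E`. -/
def Unifies (σ : X → L.Term X) (E : List (L.Term X × L.Term X)) : Prop :=
  ∀ e ∈ E, e.1.subst σ = e.2.subst σ

/-- `σ` is an idempotent most general solution of `E`: every solution `τ` factors through `σ` by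
`τ` itself. -/
def IsPrincipal (σ : X → L.Term X) (E : List (L.Term X × L.Term X)) : Prop :=
  Unifies σ E ∧ ∀ τ, Unifies τ E → ∀ z, τ z = (σ z).subst τ

theorem IsPrincipal.congr {E E' : List (L.Term X × L.Term X)} {σ : X → L.Term X}
    (h : IsPrincipal σ E) (hE : ∀ τ, Unifies τ E ↔ Unifies τ E') : IsPrincipal σ E' :=
  ⟨(hE σ).1 h.1, fun τ hτ => h.2 τ ((hE τ).2 hτ)⟩

/-- The list `E` with the variable `x` replaced by `t`. -/
def substEqs [DecidableEq X] (x : X) (t : L.Term X) (E : List (L.Term X × L.Term X)) :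
    List (L.Term X × L.Term X) :=
  E.map fun e => (e.1.subst (Function.update .var x t), e.2.subst (Function.update .var x t))

theorem subst_update_subst [DecidableEq X] (x : X) (t s : L.Term X) (σ : X → L.Term X) :
    (s.subst (Function.update .var x t)).subst σ = s.subst (Function.update σ x (t.subst σ)) := by
  rw [subst_subst]
  congr 1
  funext z
  by_cases h : z = x
  · subst h
    simp
  · simp [h, Term.subst]

theorem unifies_substEqs [DecidableEq X] {x : X} {t : L.Term X} {E : List (L.Term X × L.Term X)}
    {σ : X → L.Term X} :
    Unifies σ (substEqs x t E) ↔ Unifies (Function.update σ x (t.subst σ)) E := by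
  simp only [Unifies, substEqs, List.forall_mem_map, subst_update_subst]

theorem unifies_cons {s t : L.Term X} {E : List (L.Term X × L.Term X)} {σ : X → L.Term X} :
    Unifies σ ((s, t) :: E) ↔ s.subst σ = t.subst σ ∧ Unifies σ E := List.forall_mem_cons

theorem IsPrincipal.eliminate [DecidableEq X] {x : X} {t : L.Term X}
    {E : List (L.Term X × L.Term X)} {σ : X → L.Term X} (hx : ¬ OccursIn x t)
    (h : IsPrincipal σ (substEqs x t E)) :
    IsPrincipal (Function.update σ x (t.subst σ)) ((.var x, t) :: E) := by
  refine ⟨unifies_cons.2 ⟨?_, unifies_substEqs.1 h.1⟩, fun τ hτ => ?_⟩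
  · rw [Term.subst, Function.update_self, subst_eq_subst_iff]
    rintro z hz
    exact (Function.update_of_ne (fun e : z = x => hx (e ▸ hz)) _ _).symm
  · obtain ⟨h1, h2⟩ := unifies_cons.1 hτ
    rw [Term.subst] at h1
    have h3 : ∀ z, τ z = (σ z).subst τ :=
      h.2 τ (unifies_substEqs.2 (by rwa [← h1, Function.update_eq_self]))
    intro z
    by_cases hz : z = x
    · subst hz
      rw [Function.update_self, subst_subst, ← funext h3]
      exact h1
    · rw [Function.update_of_ne hz]
      exact h3 z

/-- The total size of the left-hand sides of the equations `E` under `τ`. -/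
def weight (τ : X → L.Term X) (E : List (L.Term X × L.Term X)) : ℕ :=
  (E.map fun e => termSize (e.1.subst τ)).sum

theorem weight_cons (τ : X → L.Term X) (s t : L.Term X) (E : List (L.Term X × L.Term X)) :
    weight τ ((s, t) :: E) = termSize (s.subst τ) + weight τ E := by
  simp [weight]

theorem weight_substEqs [DecidableEq X] {τ : X → L.Term X} {x : X} {t : L.Term X}
    (h : τ x = t.subst τ) (E : List (L.Term X × L.Term X)) :
    weight τ (substEqs x t E) = weight τ E := by
  simp only [weight, substEqs, List.map_map, Function.comp_def, subst_update_subst, ← h,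
    Function.update_eq_self]

/-- Every solvable list of equations has a most general solution. Both steps of the unification
algorithm, decomposition and elimination of a variable, keep a given solution `τ` and decrease the
size of the equations as instantiated by `τ`, which is what the induction is on. -/
theorem exists_isPrincipal {E : List (L.Term X × L.Term X)} {τ : X → L.Term X}
    (h : Unifies τ E) : ∃ σ, IsPrincipal σ E := by
  classical
  induction hn : weight τ E using Nat.strong_induction_on generalizing E with
  | _ n ih =>
  subst hn
  rcases E with _ | ⟨⟨s, t⟩, E⟩
  · exact ⟨.var, by simp [Unifies], fun τ _ z => rfl⟩
  obtain ⟨hst, hE⟩ := unifies_cons.1 h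
  have hlt : weight τ E < weight τ ((s, t) :: E) := by
    have := termSize_pos (s.subst τ)
    rw [weight_cons]
    omega
  have elim : ∀ (x : X) (r : L.Term X), τ x = r.subst τ →
      ∃ σ, IsPrincipal σ ((.var x, r) :: E) := by
    intro x r hxr
    by_cases hr : r = .var x
    · obtain ⟨σ, hσ⟩ := ih _ hlt hE rfl
      refine ⟨σ, hσ.congr fun τ => ?_⟩
      simp [unifies_cons, hr]
    · have hE' : Unifies τ (substEqs x r E) := by
        rwa [unifies_substEqs, ← hxr, Function.update_eq_self]
      obtain ⟨σ, hσ⟩ := ih _ ((weight_substEqs hxr E).trans_lt hlt) hE' rfl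
      exact ⟨_, hσ.eliminate (not_occursIn_of_unifies hxr hr)⟩
  match s, t, hst with
  | .var x, t, hst => exact elim x t hst
  | .func f ts, .var x, hst =>
    obtain ⟨σ, hσ⟩ := elim x (.func f ts) hst.symm
    exact ⟨σ, hσ.congr fun τ => by simp only [unifies_cons, eq_comm]⟩
  | .func (l := n) f ts, .func (l := m) g us, hst =>
    simp only [Term.subst, Term.func.injEq] at hst
    obtain ⟨rfl, hfg, hargs⟩ := hst
    obtain rfl := eq_of_heq hfg
    have hargs := eq_of_heq hargs
    have key : ∀ τ : X → L.Term X,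
        Unifies τ (List.ofFn (fun i => (ts i, us i)) ++ E) ↔
          Unifies τ ((.func f ts, .func f us) :: E) := by
      intro τ
      simp [Unifies, Term.subst, or_imp, forall_and, funext_iff, List.mem_ofFn]
    have hw : weight τ (List.ofFn (fun i => (ts i, us i)) ++ E) <
        weight τ ((.func f ts, .func f us) :: E) := by
      simp only [weight, List.map_append, List.sum_append, List.map_ofFn, List.sum_ofFn,
        List.map_cons, List.sum_cons, Term.subst, termSize, Function.comp_def]
      omega
    obtain ⟨σ, hσ⟩ := ih _ hw ((key τ).2 h) rfl
    exact ⟨σ, hσ.congr key⟩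

theorem exists_isMGU {s t : L.Term X} {τ : X → L.Term X} (h : s.subst τ = t.subst τ) :
    ∃ σ, IsMGU σ s t := by
  obtain ⟨σ, hσ, hmin⟩ := exists_isPrincipal (E := [(s, t)]) (τ := τ) (by simpa [Unifies] using h)
  exact ⟨σ, by simpa [Unifies] using hσ, fun τ hτ => ⟨τ, hmin τ (by simpa [Unifies] using hτ)⟩⟩

/-! ### Renaming apart -/

theorem exists_perm_apply_notMem [Infinite X] {A B : Set X} (hA : A.Finite) (hB : B.Finite) :
    ∃ π : Equiv.Perm X, ∀ z ∈ A, π z ∉ B := by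
  classical
  induction A, hA using Set.Finite.induction_on with
  | empty => exact ⟨1, by simp⟩
  | @insert a A ha hA ih =>
    obtain ⟨π, hπ⟩ := ih
    obtain ⟨y, hy⟩ := (hB.union (hA.image π)).exists_notMem
    simp only [Set.mem_union, not_or] at hy
    refine ⟨Equiv.swap (π a) y * π, ?_⟩
    rintro z (rfl | hz)
    · simpa using hy.1
    · have h1 : π z ≠ π a := fun h => ha (π.injective h ▸ hz)
      have h2 : π z ≠ y := fun h => hy.2 ⟨z, hz, h⟩
      rw [Equiv.Perm.mul_apply, Equiv.swap_apply_of_ne_of_ne h1 h2]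
      exact hπ z hz

/-! ### Redexes in an instance of a term -/

/-- A subterm `u` of `a σ` sits at a function symbol position of `a`, or below the place of a
variable of `a`. -/
theorem fill_eq_subst_cases {C : Ctx L X} {u a : L.Term X} {σ : X → L.Term X}
    (h : C.fill u = a.subst σ) :
    (∃ p r, IsFunctionPosition a p r ∧ r.subst σ = u ∧
        ∀ v, C.fill v = replaceAt (a.subst σ) p v) ∨
      ∃ (p : List ℕ) (z : X) (D : Ctx L X), subtermAt a p = some (.var z) ∧ σ z = D.fill u ∧
        ∀ v, C.fill v = replaceAt (a.subst σ) p (D.fill v) := by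
  induction C generalizing a with
  | hole =>
    cases a with
    | var z => exact .inr ⟨[], z, .hole, rfl, h.symm, fun v => (replaceAt_nil _ _).symm⟩
    | func f ts => exact .inl ⟨[], _, ⟨rfl, fun z => by simp⟩, h.symm, fun v => (replaceAt_nil _ _).symm⟩
  | @node n f i ts C ih =>
    cases a with
    | var z => exact .inr ⟨[], z, .node f i ts C, rfl, h.symm, fun v => (replaceAt_nil _ _).symm⟩
    | func g us =>
      simp only [Term.subst, Ctx.fill, Term.func.injEq] at h
      obtain ⟨rfl, hfg, hargs⟩ := h
      obtain rfl := eq_of_heq hfg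
      have hargs := eq_of_heq hargs
      have hi : C.fill u = (us i).subst σ := by simpa using congrFun hargs i
      have hfill : ∀ p v w, C.fill v = replaceAt ((us i).subst σ) p w →
          (Ctx.node f i ts C).fill v = replaceAt (Term.subst (.func f us) σ) (i :: p) w := by
        intro p v w hvw
        rw [Term.subst, replaceAt_func_cons, ← hvw, ← hargs, Function.update_idem, Ctx.fill]
      rcases ih hi with ⟨p, r, ⟨hr, hv⟩, hru, hC⟩ | ⟨p, z, D, hz, hD, hC⟩
      · exact .inl ⟨i :: p, r, ⟨by rwa [subtermAt_func_cons], hv⟩, hru,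
          fun v => hfill p v v (hC v)⟩
      · exact .inr ⟨i :: p, z, D, by rwa [subtermAt_func_cons], hD,
          fun v => hfill p v (D.fill v) (hC v)⟩

end QRewriting

/-! ### The rewriting relation of a system -/

namespace QRewriting.QTRS

open FirstOrder.Language (Term)
open QRel

section Order

variable {Ω : Type u} [CompleteLattice Ω] {L : FirstOrder.Language.{v, w}} {X : Type x}
  {T : QTRS Ω L X}

theorem le_rel_of_rule {a b : L.Term X} {ε : Ω} (h : T.rule a ε b) (C : Ctx L X)
    (σ : X → L.Term X) : ε ≤ T.rel (C.fill (a.subst σ)) (C.fill (b.subst σ)) :=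
  le_sSup (Step.ofRule C σ h)

/-- In a continuous quantale the closure conditions on the ternary rewriting relation do not
increase the degree of a pair: it is the join of the degrees of single applications of rules. -/
theorem rel_le (hΩ : IsContinuous Ω) {t s : L.Term X} {M : Ω}
    (h : ∀ (a b : L.Term X) (ε : Ω) (C : Ctx L X) (σ : X → L.Term X), T.rule a ε b →
      C.fill (a.subst σ) = t → C.fill (b.subst σ) = s → ε ≤ M) : T.rel t s ≤ M := by
  refine sSup_le fun ε hε => ?_
  induction hε with
  | ofRule C σ hr => exact h _ _ _ C σ hr rfl rfl
  | weaken _ hle ih => exact hle.trans (ih h)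
  | join ε _ ih => exact iSup_le fun i => ih i h
  | @archimedean t s ε _ ih =>
    rw [hΩ ε]
    exact sSup_le fun δ hδ => ih δ hδ h

theorem rel_map_le (hΩ : IsContinuous Ω) {φ : L.Term X → L.Term X}
    (hφ : ∀ (C : Ctx L X) (σ : X → L.Term X), ∃ (D : Ctx L X) (τ : X → L.Term X),
      ∀ a : L.Term X, φ (C.fill (a.subst σ)) = D.fill (a.subst τ)) (t s : L.Term X) :
    T.rel t s ≤ T.rel (φ t) (φ s) := by
  refine rel_le hΩ ?_
  rintro a b ε C σ hr rfl rfl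
  obtain ⟨D, τ, hD⟩ := hφ C σ
  rw [hD, hD]
  exact le_rel_of_rule hr D τ

theorem rel_fill_le (hΩ : IsContinuous Ω) (C : Ctx L X) (t s : L.Term X) :
    T.rel t s ≤ T.rel (C.fill t) (C.fill s) := by
  refine rel_map_le hΩ (fun D σ => ?_) t s
  obtain ⟨E, hE⟩ := exists_ctx_fill_fill C D
  exact ⟨E, σ, fun a => (hE _).symm⟩

theorem rel_subst_le (hΩ : IsContinuous Ω) (ρ : X → L.Term X) (t s : L.Term X) :
    T.rel t s ≤ T.rel (t.subst ρ) (s.subst ρ) := by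
  refine rel_map_le hΩ (φ := fun t => t.subst ρ) (fun D σ => ?_) t s
  obtain ⟨E, hE⟩ := exists_ctx_fill_subst D ρ
  exact ⟨E, fun z => (σ z).subst ρ, fun a => by rw [← hE, subst_subst]⟩

end Order

/-! ### Peaks -/

variable {Ω : Type u} [CommMonoid Ω] [CompleteLattice Ω] {L : FirstOrder.Language.{v, w}}
  {X : Type x} {T : QTRS Ω L X}

theorem rel_mul_rel_le [IsQuantale Ω] (hΩ : IsContinuous Ω) {t u s : L.Term X} {M : Ω}
    (h : ∀ (a₁ b₁ a₂ b₂ : L.Term X) (ε δ : Ω) (C₁ C₂ : Ctx L X) (σ₁ σ₂ : X → L.Term X),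
      T.rule a₁ ε b₁ → T.rule a₂ δ b₂ → C₁.fill (a₁.subst σ₁) = u → C₂.fill (a₂.subst σ₂) = u →
      C₁.fill (b₁.subst σ₁) = t → C₂.fill (b₂.subst σ₂) = s → ε * δ ≤ M) :
    T.rel u t * T.rel u s ≤ M := by
  rw [← Quantale.leftMulResiduation_le_iff_mul_le]
  refine rel_le hΩ fun a₁ b₁ ε C₁ σ₁ hr₁ hu₁ ht => ?_
  rw [Quantale.leftMulResiduation_le_iff_mul_le, ← Quantale.rightMulResiduation_le_iff_mul_le]
  refine rel_le hΩ fun a₂ b₂ δ C₂ σ₂ hr₂ hu₂ hs => ?_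
  rw [Quantale.rightMulResiduation_le_iff_mul_le]
  exact h a₁ b₁ a₂ b₂ ε δ C₁ C₂ σ₁ σ₂ hr₁ hr₂ hu₁ hu₂ ht hs

/-- The overlap of a redex with a function symbol position of the other redex is an instance, in a
context, of a critical pair or of an excluded overlap; the contracta coincide in the latter case. -/
theorem joins_of_overlap [LawvereanQuantale Ω] [Infinite X] (hΩ : IsContinuous Ω)
    (hcp : T.StronglyClosedOnCriticalPairs) {a₁ b₁ a₂ b₂ r : L.Term X} {ε δ : Ω}
    {σ₁ σ₂ : X → L.Term X} {p : List ℕ} (hr₁ : T.rule a₁ ε b₁) (hr₂ : T.rule a₂ δ b₂)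
    (hp : IsFunctionPosition a₂ p r) (hr : r.subst σ₂ = a₁.subst σ₁) :
    Joins T.rel (ε * δ) (replaceAt (a₂.subst σ₂) p (b₁.subst σ₁)) (b₂.subst σ₂) := by
  classical
  set V₁ : Set X := {z | OccursIn z a₁} ∪ {z | OccursIn z b₁} with hV₁
  set V₂ : Set X := {z | OccursIn z a₂} ∪ {z | OccursIn z b₂} with hV₂
  obtain ⟨π, hπ⟩ := exists_perm_apply_notMem
    ((finite_setOf_occursIn a₂).union (finite_setOf_occursIn b₂))
    ((finite_setOf_occursIn a₁).union (finite_setOf_occursIn b₁))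
  rw [← hV₁, ← hV₂] at hπ
  -- The common instance of the renamed rules.
  let τ : X → L.Term X := fun z => if z ∈ V₁ then σ₁ z else σ₂ (π.symm z)
  have ha₁ : a₁.subst τ = a₁.subst σ₁ :=
    subst_eq_subst_iff.2 fun z hz => if_pos (Or.inl hz)
  have hb₁ : b₁.subst τ = b₁.subst σ₁ :=
    subst_eq_subst_iff.2 fun z hz => if_pos (Or.inr hz)
  have hτπ : ∀ z ∈ V₂, τ (π z) = σ₂ z := fun z hz => by
    simp only [τ, if_neg (hπ z hz), Equiv.symm_apply_apply]
  have ha₂ : (a₂.relabel π).subst τ = a₂.subst σ₂ := by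
    rw [relabel_subst]
    exact subst_eq_subst_iff.2 fun z hz => hτπ z (Or.inl hz)
  have hb₂ : (b₂.relabel π).subst τ = b₂.subst σ₂ := by
    rw [relabel_subst]
    exact subst_eq_subst_iff.2 fun z hz => hτπ z (Or.inr hz)
  have hp' : subtermAt (a₂.relabel π) p = some (r.relabel π) := by
    rw [relabel_eq_subst, relabel_eq_subst]
    exact subtermAt_subst hp.1 _
  have hunif : a₁.subst τ = (r.relabel π).subst τ := by
    have h1 := subtermAt_subst hp' τ
    rw [ha₂, subtermAt_subst hp.1 σ₂, Option.some.injEq] at h1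
    rw [ha₁, ← hr, h1]
  rw [← ha₂, ← hb₁, ← hb₂]
  by_cases hex : p = [] ∧ Variants a₁ b₁ (a₂.relabel π) (b₂.relabel π) ∧
      ∀ z, OccursIn z b₁ → OccursIn z a₁
  · -- Both redexes are the same instance of variants, and it determines the contracta.
    obtain ⟨rfl, ⟨π', h1, h2⟩, hocc⟩ := hex
    rw [subtermAt_nil, Option.some.injEq] at hp'
    rw [← hp', h1, relabel_subst, subst_eq_subst_iff] at hunif
    have hb : b₁.subst τ = (b₂.relabel π).subst τ := by
      rw [h2, relabel_subst]
      exact subst_eq_subst_iff.2 fun z hz => hunif z (hocc z hz)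
    rw [replaceAt_nil, hb]
    exact Joins.refl _ _ _
  · obtain ⟨μ, hμ⟩ := exists_isMGU hunif
    obtain ⟨ρ, hρ⟩ := hμ.2 τ hunif
    have hinst : ∀ t : L.Term X, t.subst τ = (t.subst μ).subst ρ := fun t => by
      rw [subst_subst]
      exact subst_eq_subst_iff.2 fun z _ => hρ z
    have hpμ := subtermAt_subst hp' μ
    have hcrit : T.IsCriticalPair
        (replaceAt ((a₂.relabel π).subst μ) p (b₁.subst μ)) ((b₂.relabel π).subst μ) := by
      refine ⟨a₁, b₁, a₂.relabel π, b₂.relabel π, r.relabel π, ε, δ, p, μ,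
        ⟨a₁, b₁, Equiv.refl X, hr₁, ?_, ?_⟩, ⟨a₂, b₂, π, hr₂, rfl, rfl⟩, ?_, ⟨hp', ?_⟩, hμ, hex,
        rfl, rfl⟩
      · exact (Term.relabel_id a₁).symm
      · exact (Term.relabel_id b₁).symm
      · have hocc : ∀ (t : L.Term X) (z : X), OccursIn z (t.relabel π) →
            ∃ y, OccursIn y t ∧ π y = z := by
          intro t z hz
          induction t with
          | var y => exact ⟨y, occursIn_var.2 rfl, (occursIn_var.1 hz).symm⟩
          | func f ts ih =>
            obtain ⟨i, hi⟩ := occursIn_func.1 hz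
            obtain ⟨y, hy, hyz⟩ := ih i hi
            exact ⟨y, occursIn_func.2 ⟨i, hy⟩, hyz⟩
        rintro z ⟨hz₁, hz₂⟩
        obtain ⟨y, hy, rfl⟩ : ∃ y ∈ V₂, π y = z := by
          rcases hz₂ with h | h
          · obtain ⟨y, hy, hyz⟩ := hocc _ z h
            exact ⟨y, Or.inl hy, hyz⟩
          · obtain ⟨y, hy, hyz⟩ := hocc _ z h
            exact ⟨y, Or.inr hy, hyz⟩
        exact hπ y hy hz₁
      · intro z
        cases r with
        | var y => exact absurd rfl (hp.2 y)
        | func f ts => simp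
    have hpeak : ε * δ ≤ comp (conv T.rel) T.rel
        (replaceAt ((a₂.relabel π).subst μ) p (b₁.subst μ)) ((b₂.relabel π).subst μ) := by
      refine le_trans (mul_le_mul' ?_ ?_) (mul_le_comp _ _ _ ((a₂.relabel π).subst μ) _)
      · obtain ⟨C, hC⟩ := exists_ctx_fill_eq_replaceAt hpμ
        have h1 := le_rel_of_rule hr₁ C μ
        rwa [hμ.1, hC, hC, replaceAt_self hpμ] at h1
      · rw [relabel_subst, relabel_subst]
        exact le_rel_of_rule hr₂ .hole (μ ∘ π)
    obtain ⟨h1, h2⟩ := hcp _ _ hcrit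
    have hj : Joins T.rel (ε * δ) _ _ := ⟨hpeak.trans h1, hpeak.trans h2⟩
    have hj' := hj.map (rel_subst_le hΩ ρ)
    rwa [replaceAt_subst hpμ, ← hinst, ← hinst, ← hinst] at hj'

/-- A redex below a variable `z` of a linear left-hand side `a₂` has at most one copy in `b₂ σ₂`, as
`b₂` is linear too, so that each side is closed by at most one step. -/
theorem joins_of_variable [IsQuantale Ω]
    (hlin : T.Linear) {a₁ b₁ a₂ b₂ : L.Term X} {ε δ : Ω}
    {σ₁ σ₂ : X → L.Term X} {p : List ℕ} {z : X} {D : Ctx L X} (hr₁ : T.rule a₁ ε b₁)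
    (hr₂ : T.rule a₂ δ b₂) (hp : subtermAt a₂ p = some (.var z))
    (hz : σ₂ z = D.fill (a₁.subst σ₁)) (hone : ε ≤ 1) :
    Joins T.rel (ε * δ) (replaceAt (a₂.subst σ₂) p (D.fill (b₁.subst σ₁))) (b₂.subst σ₂) := by
  classical
  obtain ⟨ha₂, hb₂⟩ := hlin _ _ _ hr₂
  rw [ha₂.replaceAt_subst hp]
  set σ : X → L.Term X := Function.update σ₂ z (D.fill (b₁.subst σ₁)) with hσ
  have hright : ε ≤ reflClosure T.rel (b₂.subst σ₂) (b₂.subst σ) := by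
    by_cases hocc : OccursIn z b₂
    · obtain ⟨q, hq⟩ := hocc
      obtain ⟨C, hC⟩ := exists_ctx_fill_eq_replaceAt (subtermAt_subst hq σ₂)
      obtain ⟨E, hE⟩ := exists_ctx_fill_fill C D
      have h1 := le_rel_of_rule hr₁ E σ₁
      rw [hE, hE, hC, hC, hb₂.replaceAt_subst hq, hb₂.replaceAt_subst hq, ← hz,
        Function.update_eq_self] at h1
      exact h1.trans (le_reflClosure _ _ _)
    · have h1 : b₂.subst σ₂ = b₂.subst σ := subst_eq_subst_iff.2 fun y hy =>
        (Function.update_of_ne (fun e : y = z => hocc (e ▸ hy)) _ _).symm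
      rw [h1]
      exact hone.trans ((diag_self _).ge.trans (diag_le_reflClosure T.rel _ _))
  have hleft : δ ≤ reflClosure T.rel (a₂.subst σ) (b₂.subst σ) :=
    (le_rel_of_rule hr₂ .hole σ).trans (le_reflClosure _ _ _)
  rw [mul_comm]
  exact Joins.of_le hleft hright

theorem joins_of_fill_eq_subst [LawvereanQuantale Ω] [Infinite X] (hΩ : IsContinuous Ω)
    (hlin : T.Linear) (hcp : T.StronglyClosedOnCriticalPairs) {a₁ b₁ a₂ b₂ : L.Term X} {ε δ : Ω}
    {σ₁ σ₂ : X → L.Term X} {C : Ctx L X} (hr₁ : T.rule a₁ ε b₁) (hr₂ : T.rule a₂ δ b₂)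
    (h : C.fill (a₁.subst σ₁) = a₂.subst σ₂) :
    Joins T.rel (ε * δ) (C.fill (b₁.subst σ₁)) (b₂.subst σ₂) := by
  rcases fill_eq_subst_cases h with ⟨p, r, hp, hr, hC⟩ | ⟨p, z, D, hp, hz, hC⟩
  · rw [hC]
    exact joins_of_overlap hΩ hcp hr₁ hr₂ hp hr
  · rw [hC]
    exact joins_of_variable hlin hr₁ hr₂ hp hz (le_top.trans_eq LawvereanQuantale.integral.symm)

theorem joins_of_fill_eq_fill [LawvereanQuantale Ω] [Infinite X] (hΩ : IsContinuous Ω)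
    (hlin : T.Linear) (hcp : T.StronglyClosedOnCriticalPairs) {a₁ b₁ a₂ b₂ : L.Term X} {ε δ : Ω}
    {σ₁ σ₂ : X → L.Term X} {C₁ C₂ : Ctx L X} (hr₁ : T.rule a₁ ε b₁) (hr₂ : T.rule a₂ δ b₂)
    (h : C₁.fill (a₁.subst σ₁) = C₂.fill (a₂.subst σ₂)) :
    Joins T.rel (ε * δ) (C₁.fill (b₁.subst σ₁)) (C₂.fill (b₂.subst σ₂)) := by
  induction C₁ generalizing C₂ with
  | hole =>
    rw [mul_comm]
    exact (joins_of_fill_eq_subst hΩ hlin hcp hr₂ hr₁ h.symm).symm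
  | @node n f i ts C₁ ih =>
    cases C₂ with
    | hole => exact joins_of_fill_eq_subst hΩ hlin hcp hr₁ hr₂ h
    | node g j us C₂ =>
      simp only [Ctx.fill, Term.func.injEq] at h
      obtain ⟨rfl, hfg, hargs⟩ := h
      obtain rfl := eq_of_heq hfg
      have hargs := eq_of_heq hargs
      by_cases hij : i = j
      · subst hij
        have hi := congrFun hargs i
        simp only [Function.update_self] at hi
        have hus : ∀ v, (Ctx.node f i us C₂).fill v = (Ctx.node f i ts C₂).fill v := by
          intro v
          simp only [Ctx.fill]
          congr 1
          have h1 := congrArg (fun w => Function.update w i (C₂.fill v)) hargs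
          simpa only [Function.update_idem] using h1.symm
        rw [hus]
        have hmap := (ih hi).map (φ := (Ctx.node f i ts .hole).fill)
          (rel_fill_le hΩ (.node f i ts .hole))
        simp only [Ctx.fill] at hmap ⊢
        exact hmap
      · have hj : ts j = C₂.fill (a₂.subst σ₂) := by
          simpa [Ne.symm hij] using congrFun hargs j
        have hi : us i = C₁.fill (a₁.subst σ₁) := by
          simpa [hij] using (congrFun hargs i).symm
        set B₁ := C₁.fill (b₁.subst σ₁) with hB₁
        set B₂ := C₂.fill (b₂.subst σ₂) with hB₂
        have hleft := le_rel_of_rule hr₂ (.node f j (Function.update ts i B₁) C₂) σ₂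
        have hright := le_rel_of_rule hr₁ (.node f i (Function.update us j B₂) C₁) σ₁
        -- Contracting either redex and then the other one gives the same term.
        have hcomm : Function.update (Function.update us j B₂) i B₁ =
            Function.update (Function.update ts i B₁) j B₂ := by
          have h1 := congrArg (fun w => Function.update (Function.update w j B₂) i B₁) hargs
          simp only [Function.update_idem] at h1
          rw [← h1, Function.update_comm hij, Function.update_idem,
            Function.update_comm (Ne.symm hij)]
        have h1 : Function.update (Function.update ts i B₁) j (C₂.fill (a₂.subst σ₂)) =
            Function.update ts i B₁ := by
          rw [← hj, Function.update_eq_self_iff, Function.update_of_ne (Ne.symm hij)]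
        have h2 : Function.update (Function.update us j B₂) i (C₁.fill (a₁.subst σ₁)) =
            Function.update us j B₂ := by
          rw [← hi, Function.update_eq_self_iff, Function.update_of_ne hij]
        simp only [Ctx.fill] at hleft hright ⊢
        rw [h1] at hleft
        rw [h2, ← hB₁, hcomm] at hright
        rw [mul_comm]
        exact Joins.of_le (hleft.trans (le_reflClosure _ _ _))
          (hright.trans (le_reflClosure _ _ _))

theorem Linear.stronglyClosed [LawvereanQuantale Ω] [Infinite X] (hlin : T.Linear)
    (hΩ : IsContinuous Ω) (hcp : T.StronglyClosedOnCriticalPairs) : StronglyClosed T.rel := by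
  constructor
  all_goals
    refine fun t s => iSup_le fun u => rel_mul_rel_le hΩ ?_
    rintro a₁ b₁ a₂ b₂ ε δ C₁ C₂ σ₁ σ₂ hr₁ hr₂ hu₁ hu₂ rfl rfl
    have hj := joins_of_fill_eq_fill hΩ hlin hcp hr₁ hr₂ (hu₁.trans hu₂.symm)
  · exact hj.1
  · exact hj.2

end QRewriting.QTRS

theorem mainTheorem5 (Ω : Type u) [CommMonoid Ω] [CompleteLattice Ω]
    [QRewriting.LawvereanQuantale Ω] :
    (∀ (A : Type y) (R : QRewriting.QRel Ω A A),
        QRewriting.QRel.StronglyConfluent R → QRewriting.QRel.Confluent R) ∧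
    (QRewriting.IsContinuous Ω →
      ∀ (L : FirstOrder.Language.{v, w}) (X : Type x) [Countable X] [Infinite X]
        (T : QRewriting.QTRS Ω L X), T.Linear →
        (QRewriting.QRel.StronglyClosed T.rel ↔ T.StronglyClosedOnCriticalPairs) ∧
        (T.StronglyClosedOnCriticalPairs → QRewriting.QRel.Confluent T.rel)) := by
  refine ⟨fun A R h => h.confluent, fun hΩ L X _ _ T hlin => ⟨⟨fun h t s _ => ⟨h.1 t s, h.2 t s⟩,
    hlin.stronglyClosed hΩ⟩, fun h => (hlin.stronglyClosed hΩ h).1.confluent⟩⟩
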